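/- Let $n\ge 2$ and let $L^2_\sigma$ be the space of all $v\in L^2(\mathbb R^n,\mathbb R^n)$ with $\operatorname{div} v=0$ in the sense of distributions, with the $L^2$ norm. For $2\le p\le\infty$ let $L^p_tL^2_{\sigma,x}$ be the Bochner space $L^p([0,\infty);L^2_\sigma)$, with norm denoted $\|\cdot\|_{L^p_tL^2_x}$. Given $u^0\in L^2_\sigma$, a map $u\in L^p_tL^2_{\sigma,x}$ is called a weak solution of the Cauchy problem for the incompressible Euler equations on $\mathbb R^n\times[0,\infty)$ with initial datum $u^0$ if $$\int_0^\infty\!\!\int_{\mathbb R^n}\big(u\cdot\partial_t\varphi+u\otimes u:\mathrm D\varphi\big)\,dx\,dt+\int_{\mathbb R^n}u^0\cdot\varphi(\cdot,0)\,dx=0$$ for every $\varphi\in C_c^\infty(\mathbb R^n\times[0,\infty),\mathbb R^n)$ with $\operatorname{div}_x\varphi=0$. (i) For every $2<p<\infty$ and every $M>0$, the set of initial data $u^0\in L^2_\sigma$ for which there is a weak solution $u\in L^p_tL^2_{\sigma,x}$ with $\|u\|_{L^p_tL^2_x}\le M$ is nowhere dense in $L^2_\sigma$. (ii) There is a residual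 $G_\delta$ set $G\subset L^2_\sigma$ such that for every $u^0\in G$ the Cauchy problem has no weak solution $u\in L^\infty_tL^2_{\sigma,x}\cap\bigcup_{2<p<\infty}L^p_tL^2_{\sigma,x}$. -/

import Mathlib

open MeasureTheory Set
open scoped ENNReal ContDiff

/-- Euclidean space `ℝⁿ`. -/
abbrev EulerSpace (n : ℕ) : Type := EuclideanSpace ℝ (Fin n)

/-- A smooth compactly supported scalar `η` has differential which is bounded and of compact
support, so its pairing `v · ∇η = Dη(v)` with a square integrable field is integrable. -/
theorem integrable_fderiv_apply {n : ℕ} (v : Lp (EulerSpace n) 2 (volume : Measure (EulerSpace n)))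
    {η : EulerSpace n → ℝ} (hη : ContDiff ℝ ∞ η) (hc : HasCompactSupport η) :
    Integrable (fun x => fderiv ℝ η x (v x)) volume := by
  have hcont : Continuous (fderiv ℝ η) := hη.continuous_fderiv (by simp)
  have h1 : MemLp (fderiv ℝ η) 2 (volume : Measure (EulerSpace n)) :=
    hcont.memLp_of_hasCompactSupport (hc.fderiv ℝ)
  have h2 := Lp.memLp v
  have h3 : Integrable (fun x => ‖fderiv ℝ η x‖ * ‖v x‖) volume := h1.norm.integrable_mul h2.norm
  refine h3.mono' ?_ (Filter.Eventually.of_forall fun x => (fderiv ℝ η x).le_opNorm (v x))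
  exact (ContinuousLinearMap.apply ℝ ℝ).flip.aestronglyMeasurable_comp₂
    hcont.aestronglyMeasurable h2.1

/-- The space `L²_σ` of square integrable vector fields on `ℝⁿ` whose distributional divergence
vanishes: `∫ v · ∇η dx = 0` for every scalar test function `η` (note `v · ∇η = Dη(v)`).
It carries the norm and the topology of `L²`. -/
def L2Solenoidal (n : ℕ) : Submodule ℝ (Lp (EulerSpace n) 2 (volume : Measure (EulerSpace n))) where
  carrier := {v | ∀ η : EulerSpace n → ℝ, ContDiff ℝ ∞ η → HasCompactSupport η →
    ∫ x, fderiv ℝ η x (v x) = 0}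
  zero_mem' := by
    intro η _ _
    rw [integral_eq_zero_of_ae]
    filter_upwards [Lp.coeFn_zero (EulerSpace n) 2 (volume : Measure (EulerSpace n))] with x hx
    rw [hx, Pi.zero_apply, map_zero]
    rfl
  add_mem' := by
    intro v w hv hw η hη hc
    have h : ∫ x, fderiv ℝ η x ((v + w : Lp (EulerSpace n) 2 volume) x)
        = ∫ x, (fderiv ℝ η x (v x) + fderiv ℝ η x (w x)) := by
      refine integral_congr_ae ?_
      filter_upwards [Lp.coeFn_add v w] with x hx
      rw [hx, Pi.add_apply, map_add]
    rw [h, integral_add (integrable_fderiv_apply v hη hc) (integrable_fderiv_apply w hη hc),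
      hv η hη hc, hw η hη hc, add_zero]
  smul_mem' := by
    intro c v hv η hη hc
    have h : ∫ x, fderiv ℝ η x ((c • v : Lp (EulerSpace n) 2 volume) x)
        = ∫ x, c * fderiv ℝ η x (v x) := by
      refine integral_congr_ae ?_
      filter_upwards [Lp.coeFn_smul c v] with x hx
      rw [hx, Pi.smul_apply, map_smul, smul_eq_mul]
    rw [h, integral_const_mul, hv η hη hc, mul_zero]

/-- The divergence `∑ᵢ ∂ᵢ ψᵢ` of a vector field on `ℝⁿ`. -/
noncomputable def eulerDiv {n : ℕ} (ψ : EulerSpace n → EulerSpace n) (x : EulerSpace n) : ℝ :=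
  ∑ i : Fin n, (fderiv ℝ ψ x (EuclideanSpace.single i 1)) i

/-- The test class `C^∞_{c,σ}(ℝⁿ × [0,∞), ℝⁿ)`: vector fields `φ(t, x)` that are smooth up to
`t = 0` (presented as restrictions of smooth fields on `ℝ × ℝⁿ`), have compact support, which may
meet `t = 0`, and are divergence free in `x` at every time `t ≥ 0`. -/
structure IsSolenoidalTest {n : ℕ} (φ : ℝ → EulerSpace n → EulerSpace n) : Prop where
  smooth : ContDiff ℝ ∞ (fun z : ℝ × EulerSpace n => φ z.1 z.2)
  compactSupport : HasCompactSupport (fun z : ℝ × EulerSpace n => φ z.1 z.2)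
  divFree : ∀ t : ℝ, 0 ≤ t → ∀ x : EulerSpace n, eulerDiv (φ t) x = 0

/-- Lebesgue measure on the time axis `[0,∞)`. The Bochner space `L^p_t L²_{σ,x}` consists of the
`u : ℝ → L2Solenoidal n` with `MemLp u p timeMeasure`; its norm is `eLpNorm u p timeMeasure`. -/
noncomputable def timeMeasure : Measure ℝ := volume.restrict (Ici 0)

/-- The weak formulation of the incompressible Euler Cauchy problem on `ℝⁿ × [0,∞)` with initial
datum `u0`:
`∫₀^∞ ∫ (u · ∂ₜφ + u ⊗ u : Dφ) dx dt + ∫ u0 · φ(·,0) dx = 0` for all solenoidal test fields `φ`.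
Here `u ⊗ u : Dφ = ∑ᵢⱼ uᵢ uⱼ ∂ⱼφᵢ = u · (Dφ)u`. Incompressibility of `u` is part of its type. -/
def IsWeakEulerSolution {n : ℕ} (u0 : L2Solenoidal n) (u : ℝ → L2Solenoidal n) : Prop :=
  ∀ φ : ℝ → EulerSpace n → EulerSpace n, IsSolenoidalTest φ →
    (∫ t, (∫ x, (inner ℝ ((u t).1 x) (deriv (fun s => φ s x) t)
        + inner ℝ ((u t).1 x) (fderiv ℝ (φ t) x ((u t).1 x)))) ∂timeMeasure)
      + ∫ x, inner ℝ (u0.1 x) (φ 0 x) = 0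

/-! Testing the equation with φ = χ(t)ψ(x), where χ(0) = 1, χ vanishes beyond time S and |χ'| ≤ C/S,
bounds the pairing of the datum with ψ. By Hölder in time, ‖u‖ ≤ M gives |⟨u⁰, ψ⟩| ≤ C M S^(-1/p)
‖ψ‖ + sup|Dψ| M² S^(1-2/p). As p < ∞, a large S makes the first term small relative to ‖ψ‖. With S
fixed, dilating ψ in space makes sup|Dψ|/‖ψ‖ as small as desired, which handles the second. So the
solvable data lie in arbitrarily thin closed slabs (`exists_slab`), and their closure contains no
ball. For (ii), boundedness in time raises the exponent to an integer (`MemLp.of_memLp_top_of_le`),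
so countably many such closures cover all solvable data. -/

/-- A smooth compactly supported divergence free vector field. -/
structure IsSolenoidalField {n : ℕ} (ψ : EulerSpace n → EulerSpace n) : Prop where
  smooth : ContDiff ℝ ∞ ψ
  compactSupport : HasCompactSupport ψ
  divFree : ∀ x, eulerDiv ψ x = 0

/-! ### Solenoidal fields and their dilations -/

/-- Coordinatewise integration by parts: ∫ ψ · ∇η = -∫ (div ψ) η. -/
theorem IsSolenoidalField.toLp_mem {n : ℕ} {ψ : EulerSpace n → EulerSpace n}
    (h : IsSolenoidalField ψ) (hL : MemLp ψ 2 (volume : Measure (EulerSpace n))) :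
    hL.toLp ψ ∈ L2Solenoidal n := by
  intro η hη hc
  have hcoord : ∀ i : Fin n, ContDiff ℝ ∞ (fun x => ψ x i) := fun i =>
    (EuclideanSpace.proj (𝕜 := ℝ) i).contDiff.comp h.smooth
  have hcoordc : ∀ i : Fin n, HasCompactSupport (fun x => ψ x i) := fun i =>
    h.compactSupport.comp_left (g := fun y : EulerSpace n => y i) rfl
  have hfd : ∀ (i : Fin n) (x : EulerSpace n),
      fderiv ℝ (fun x => ψ x i) x (EuclideanSpace.single i 1)
        = (fderiv ℝ ψ x (EuclideanSpace.single i 1)) i := by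
    intro i x
    have := ((EuclideanSpace.proj (𝕜 := ℝ) i).hasFDerivAt.comp x
      (h.smooth.differentiable (by simp) x).hasFDerivAt).fderiv
    exact DFunLike.congr_fun this _
  have hcη : ∀ v : EulerSpace n, Continuous fun x => fderiv ℝ η x v := fun v =>
    (hη.continuous_fderiv (by simp)).clm_apply continuous_const
  have hcψ : ∀ (i : Fin n) (v : EulerSpace n), Continuous fun x => fderiv ℝ (fun x => ψ x i) x v :=
    fun i v => ((hcoord i).continuous_fderiv (by simp)).clm_apply continuous_const
  have hint : ∀ i : Fin n, Integrable (fun x => ψ x i * fderiv ℝ η x (EuclideanSpace.single i 1)) :=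
    fun i => ((hcoord i).continuous.mul (hcη _)).integrable_of_hasCompactSupport
      (hcoordc i).mul_right
  have hint' : ∀ i : Fin n,
      Integrable (fun x => fderiv ℝ (fun x => ψ x i) x (EuclideanSpace.single i 1) * η x) :=
    fun i => ((hcψ i _).mul hη.continuous).integrable_of_hasCompactSupport hc.mul_left
  have h1 : ∫ x, fderiv ℝ η x (hL.toLp ψ x)
      = ∫ x, ∑ i : Fin n, ψ x i * fderiv ℝ η x (EuclideanSpace.single i 1) := by
    refine integral_congr_ae ?_
    filter_upwards [hL.coeFn_toLp] with x hx
    rw [hx]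
    conv_lhs => rw [← (EuclideanSpace.basisFun (Fin n) ℝ).sum_repr (ψ x)]
    simp
  have h2 : ∀ i : Fin n, ∫ x, ψ x i * fderiv ℝ η x (EuclideanSpace.single i 1)
      = - ∫ x, fderiv ℝ (fun x => ψ x i) x (EuclideanSpace.single i 1) * η x := fun i =>
    integral_mul_fderiv_eq_neg_fderiv_mul_of_integrable (hint' i) (hint i)
      (((hcoord i).continuous.mul hη.continuous).integrable_of_hasCompactSupport
        (hcoordc i).mul_right)
      (fun x _ => (hcoord i).differentiable (by simp) x)
      (fun x _ => hη.differentiable (by simp) x)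
  rw [h1, integral_finsetSum _ fun i _ => hint i, Finset.sum_congr rfl fun i _ => h2 i,
    Finset.sum_neg_distrib, ← integral_finsetSum _ fun i _ => hint' i, neg_eq_zero]
  refine integral_eq_zero_of_ae (Filter.Eventually.of_forall fun x => ?_)
  simp only [hfd, ← Finset.sum_mul]
  have := h.divFree x
  rw [eulerDiv] at this
  simp [this]

theorem exists_skew_ne_zero {n : ℕ} (hn : 2 ≤ n) :
    ∃ J : EulerSpace n →L[ℝ] EulerSpace n, (∀ x, inner ℝ x (J x) = 0) ∧ ∃ x, J x ≠ 0 := by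
  let i : Fin n := ⟨0, by omega⟩
  let j : Fin n := ⟨1, by omega⟩
  have hij : j ≠ i := by simp [i, j]
  refine ⟨(EuclideanSpace.proj (𝕜 := ℝ) i).smulRight (EuclideanSpace.single j 1)
    - (EuclideanSpace.proj (𝕜 := ℝ) j).smulRight (EuclideanSpace.single i 1), fun x => ?_,
    EuclideanSpace.single i 1, fun h => ?_⟩
  · simp [inner_sub_right, inner_smul_right, EuclideanSpace.inner_single_right, mul_comm]
  · have := congrArg (fun y : EulerSpace n => y j) h
    simp [hij] at this

/-- A rotation field Jx, J skew, cut off by a radial g. Its divergence is g tr J + ∇g · Jx; the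
trace vanishes, and ∇g is parallel to x, hence orthogonal to Jx. -/
theorem exists_solenoidalField_ne_zero {n : ℕ} (hn : 2 ≤ n) :
    ∃ ψ : EulerSpace n → EulerSpace n, IsSolenoidalField ψ ∧ ∃ x, ψ x ≠ 0 := by
  obtain ⟨J, hJ, x₀, hx₀⟩ := exists_skew_ne_zero hn
  -- g is 1 on the closed unit ball, where the nonvanishing point is found, and 0 once ‖x‖² ≥ 2.
  let g : EulerSpace n → ℝ := fun x => Real.smoothTransition (2 - ‖x‖ ^ 2)
  have hg : ContDiff ℝ ∞ g :=
    Real.smoothTransition.contDiff.comp (contDiff_const.sub (contDiff_norm_sq ℝ))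
  have hgJ : ∀ x, fderiv ℝ g x (J x) = 0 := by
    intro x
    have h1 : HasFDerivAt (fun x : EulerSpace n => 2 - ‖x‖ ^ 2) (-(2 • innerSL ℝ x)) x :=
      (hasStrictFDerivAt_norm_sq x).hasFDerivAt.const_sub 2
    have h2 : DifferentiableAt ℝ Real.smoothTransition (2 - ‖x‖ ^ 2) :=
      (Real.smoothTransition.contDiff (n := ⊤)).differentiable (by simp) _
    have h3 := (h2.hasDerivAt.comp_hasFDerivAt x h1).fderiv
    have h4 : fderiv ℝ g x = _ := h3
    rw [h4]
    simp [hJ x]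
  refine ⟨fun x => g x • J x, ⟨hg.smul J.contDiff, ?_, fun x => ?_⟩, ‖x₀‖⁻¹ • x₀, ?_⟩
  · refine HasCompactSupport.intro (isCompact_closedBall 0 2) fun x hx => ?_
    have : 2 < ‖x‖ := by simpa using hx
    have : g x = 0 := Real.smoothTransition.zero_of_nonpos (by nlinarith)
    simp [this]
  · have h1 : fderiv ℝ (fun x => g x • J x) x = g x • (J : EulerSpace n →L[ℝ] EulerSpace n)
        + (fderiv ℝ g x).smulRight (J x) := by
      have := fderiv_fun_smul (hg.differentiable (by simp) x) (J.differentiableAt (x := x))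
      rw [this, J.fderiv]
    have h2 : ∀ i : Fin n, (J (EuclideanSpace.single i 1)) i = 0 := fun i => by
      have := hJ (EuclideanSpace.single i 1)
      simpa [EuclideanSpace.inner_single_left] using this
    have h3 : fderiv ℝ g x (J x)
        = ∑ i : Fin n, fderiv ℝ g x (EuclideanSpace.single i 1) * (J x) i := by
      conv_lhs => rw [← (EuclideanSpace.basisFun (Fin n) ℝ).sum_repr (J x)]
      simp [mul_comm]
    rw [eulerDiv, h1, ← hgJ x, h3]
    simp [h2]
  · have hx : x₀ ≠ 0 := fun h => hx₀ (by rw [h, map_zero])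
    have h1 : ‖‖x₀‖⁻¹ • x₀‖ = 1 := norm_smul_inv_norm (𝕜 := ℝ) hx
    have h2 : g (‖x₀‖⁻¹ • x₀) = 1 := by
      refine Real.smoothTransition.one_of_one_le ?_
      rw [h1]; norm_num
    simp only [h2, one_smul, map_smul]
    exact smul_ne_zero (inv_ne_zero (norm_ne_zero_iff.2 hx)) hx₀

theorem fderiv_comp_inv_smul {n : ℕ} {ψ : EulerSpace n → EulerSpace n}
    (hψ : Differentiable ℝ ψ) (l : ℝ) (x : EulerSpace n) :
    fderiv ℝ (fun x => ψ (l⁻¹ • x)) x = l⁻¹ • fderiv ℝ ψ (l⁻¹ • x) := by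
  have h1 : HasFDerivAt (fun x : EulerSpace n => l⁻¹ • x)
      (l⁻¹ • ContinuousLinearMap.id ℝ (EulerSpace n)) x := (hasFDerivAt_id x).const_smul l⁻¹
  have h2 := ((hψ (l⁻¹ • x)).hasFDerivAt.comp x h1).fderiv
  ext1 v
  refine (DFunLike.congr_fun h2 v).trans ?_
  simp

theorem IsSolenoidalField.comp_inv_smul {n : ℕ} {ψ : EulerSpace n → EulerSpace n}
    (h : IsSolenoidalField ψ) {l : ℝ} (hl : l ≠ 0) :
    IsSolenoidalField fun x => ψ (l⁻¹ • x) where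
  smooth := h.smooth.comp (contDiff_const_smul _)
  compactSupport := h.compactSupport.comp_homeomorph (Homeomorph.smulOfNeZero l⁻¹ (inv_ne_zero hl))
  divFree x := by
    have := h.divFree (l⁻¹ • x)
    rw [eulerDiv] at this
    simp [eulerDiv, fderiv_comp_inv_smul (h.smooth.differentiable (by simp)), ← Finset.mul_sum,
      this]

/-- Dilating a solenoidal test field makes its differential uniformly small in comparison with
its `L²` norm. -/
theorem exists_solenoidalField_fderiv_le {n : ℕ} (hn : 2 ≤ n) {ε : ℝ} (hε : 0 < ε) :
    ∃ (ψ : EulerSpace n → EulerSpace n) (w : L2Solenoidal n), IsSolenoidalField ψ ∧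
      w.1 =ᵐ[volume] ψ ∧ 0 < ‖w‖ ∧ ∀ x, ‖fderiv ℝ ψ x‖ ≤ ε * ‖w‖ := by
  obtain ⟨ψ, hψ, x₀, hx₀⟩ := exists_solenoidalField_ne_zero hn
  obtain ⟨C, hC⟩ := (hψ.compactSupport.fderiv ℝ).exists_bound_of_continuous
    (hψ.smooth.continuous_fderiv (by simp))
  have hC0 : 0 ≤ C := (norm_nonneg _).trans (hC 0)
  set I : ℝ := ∫ x, ‖ψ x‖ ^ 2 with hI
  have hI0 : 0 < I := by
    refine (hψ.smooth.continuous.norm.pow 2).integral_pos_of_hasCompactSupport_nonneg_nonzero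
      ?_ (fun x => by positivity) (x := x₀) (by simpa using hx₀)
    exact hψ.compactSupport.comp_left (g := fun y : EulerSpace n => ‖y‖ ^ 2) (by simp)
  -- The second entry gives C / l ≤ ε√I; l ≥ 1 ensures that the dilation, which multiplies the
  -- squared norm by lⁿ, does not decrease it.
  set l : ℝ := max 1 (C / (ε * √I)) with hl
  have hl1 : 1 ≤ l := le_max_left _ _
  have hl0 : 0 < l := by positivity
  have hs := hψ.comp_inv_smul hl0.ne'
  have hL : MemLp (fun x => ψ (l⁻¹ • x)) 2 (volume : Measure (EulerSpace n)) :=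
    hs.smooth.continuous.memLp_of_hasCompactSupport hs.compactSupport
  have hnorm : √I ≤ ‖hL.toLp‖ := by
    refine Real.sqrt_le_iff.2 ⟨norm_nonneg _, ?_⟩
    have h1 : ‖hL.toLp‖ ^ 2 = ∫ x, ‖ψ (l⁻¹ • x)‖ ^ 2 := by
      rw [← real_inner_self_eq_norm_sq, L2.inner_def]
      refine integral_congr_ae ?_
      filter_upwards [hL.coeFn_toLp] with x hx
      rw [hx, real_inner_self_eq_norm_sq]
    rw [h1, Measure.integral_comp_inv_smul volume (fun x => ‖ψ x‖ ^ 2) l, smul_eq_mul,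
      abs_of_pos (by positivity)]
    exact le_mul_of_one_le_left hI0.le (one_le_pow₀ hl1)
  refine ⟨_, ⟨hL.toLp, hs.toLp_mem hL⟩, hs, hL.coeFn_toLp,
    lt_of_lt_of_le (Real.sqrt_pos.2 hI0) hnorm, fun x => ?_⟩
  rw [fderiv_comp_inv_smul (hψ.smooth.differentiable (by simp)), norm_smul, norm_inv,
    Real.norm_of_nonneg hl0.le]
  refine le_trans ?_ (mul_le_mul_of_nonneg_left hnorm hε.le)
  have hsI : 0 < √I := Real.sqrt_pos.2 hI0
  have h2 : C / (ε * √I) ≤ l := le_max_right _ _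
  rw [div_le_iff₀ (by positivity)] at h2
  calc l⁻¹ * ‖fderiv ℝ ψ (l⁻¹ • x)‖ ≤ l⁻¹ * (l * (ε * √I)) := by
        gcongr
        exact (hC _).trans h2
    _ = ε * √I := by field_simp

/-! ### Time cutoffs and separated test fields -/

/-- All cutoffs are rescalings of one bump, so C does not depend on S. -/
theorem exists_time_cutoff : ∃ C : ℝ, 0 ≤ C ∧ ∀ S : ℝ, 0 < S → ∃ χ : ℝ → ℝ, ContDiff ℝ ∞ χ ∧
    χ 0 = 1 ∧ (∀ t, |χ t| ≤ 1) ∧ (∀ t, S < |t| → χ t = 0) ∧ ∀ t, |deriv χ t| ≤ C / S := by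
  let b : ℝ → ℝ := fun t => Real.smoothTransition (2 - 2 * t ^ 2)
  have hb : ContDiff ℝ ∞ b := Real.smoothTransition.contDiff.comp (by fun_prop)
  have hb0 : ∀ t, 1 < |t| → b t = 0 := fun t ht => by
    refine Real.smoothTransition.zero_of_nonpos ?_
    have : 1 < t ^ 2 := (one_lt_sq_iff_one_lt_abs t).2 ht
    linarith
  have hbc : HasCompactSupport b := HasCompactSupport.intro (isCompact_Icc (a := (-1 : ℝ)) (b := 1))
    fun t ht => hb0 t (by
      by_contra! h
      exact ht (abs_le.1 h))
  obtain ⟨C, hC⟩ := hbc.deriv.exists_bound_of_continuous (hb.continuous_deriv (by simp))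
  refine ⟨C, (norm_nonneg _).trans (hC 0), fun S hS => ⟨fun t => b (S⁻¹ * t), ?_, ?_, ?_, ?_, ?_⟩⟩
  · exact hb.comp (contDiff_const.mul contDiff_id)
  · simp [b, Real.smoothTransition.one_of_one_le]
  · intro t
    rw [abs_of_nonneg (Real.smoothTransition.nonneg _)]
    exact Real.smoothTransition.le_one _
  · intro t ht
    refine hb0 _ ?_
    rw [abs_mul, abs_inv, abs_of_pos hS, ← div_eq_inv_mul, one_lt_div hS]
    exact ht
  · intro t
    have h1 := (hb.differentiable (by simp) (S⁻¹ * t)).hasDerivAt.comp t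
      ((hasDerivAt_id t).const_mul S⁻¹)
    have h2 : deriv (fun t => b (S⁻¹ * t)) t = deriv b (S⁻¹ * t) * (S⁻¹ * 1) := h1.deriv
    rw [h2, mul_one, abs_mul, abs_inv, abs_of_pos hS, ← div_eq_mul_inv]
    exact div_le_div_of_nonneg_right (hC _) hS.le

theorem deriv_eq_zero_of_lt {χ : ℝ → ℝ} {S t : ℝ} (h : ∀ t, S < |t| → χ t = 0) (ht : S < |t|) :
    deriv χ t = 0 := by
  have : χ =ᶠ[nhds t] fun _ => 0 := by
    filter_upwards [continuous_abs.continuousAt.eventually (lt_mem_nhds ht)] with s hs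
    exact h s hs
  rw [this.deriv_eq, deriv_const]

theorem IsSolenoidalField.isSolenoidalTest {n : ℕ} {ψ : EulerSpace n → EulerSpace n}
    (h : IsSolenoidalField ψ) {χ : ℝ → ℝ} (hχ : ContDiff ℝ ∞ χ) {S : ℝ}
    (hS : ∀ t, S < |t| → χ t = 0) : IsSolenoidalTest fun t x => χ t • ψ x where
  smooth := (hχ.comp contDiff_fst).smul (h.smooth.comp contDiff_snd)
  compactSupport := by
    refine HasCompactSupport.intro ((isCompact_Icc (a := -S) (b := S)).prod h.compactSupport)
      fun z hz => ?_
    rcases not_and_or.1 hz with h1 | h1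
    · rw [hS z.1 (by by_contra! h; exact h1 (abs_le.1 h)), zero_smul]
    · rw [image_eq_zero_of_notMem_tsupport h1, smul_zero]
  divFree t _ x := by
    have h1 := h.divFree x
    rw [eulerDiv] at h1
    have h2 : fderiv ℝ (fun x => χ t • ψ x) x = χ t • fderiv ℝ ψ x :=
      fderiv_fun_const_smul (h.smooth.differentiable (by simp) x) _
    simp [eulerDiv, h2, ← Finset.mul_sum, h1]

/-! ### Estimates for the weak formulation -/

/-- The spatial integral at a fixed time, with a = χ'(t) and c = χ(t): Cauchy–Schwarz for the linear
term, the sup bound on Dψ for the quadratic one. -/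
theorem abs_integral_pairing_le {n : ℕ} {ψ : EulerSpace n → EulerSpace n} {w : L2Solenoidal n}
    (h : IsSolenoidalField ψ) (hw : w.1 =ᵐ[volume] ψ) {D : ℝ} (hD : ∀ x, ‖fderiv ℝ ψ x‖ ≤ D)
    (v : L2Solenoidal n) (a c : ℝ) :
    |∫ x, (inner ℝ (v.1 x) (a • ψ x) + inner ℝ (v.1 x) ((c • fderiv ℝ ψ x) (v.1 x)))|
      ≤ |a| * (‖v‖ * ‖w‖) + |c| * (D * ‖v‖ ^ 2) := by
  have hv := Lp.memLp v.1
  have hv2 : ∫ x, ‖v.1 x‖ ^ 2 = ‖v‖ ^ 2 := by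
    rw [← Submodule.norm_coe, ← real_inner_self_eq_norm_sq, L2.inner_def]
    simp only [real_inner_self_eq_norm_sq]
  have hi1 : Integrable (fun x => inner ℝ (v.1 x) (w.1 x)) := L2.integrable_inner (𝕜 := ℝ) v.1 w.1
  have hi1' : Integrable (fun x => inner ℝ (v.1 x) (a • ψ x)) := by
    refine (hi1.const_mul a).congr ?_
    filter_upwards [hw] with x hx
    rw [hx, inner_smul_right]
  have hi2 : Integrable (fun x => |c| * (D * ‖v.1 x‖ ^ 2)) :=
    ((hv.integrable_norm_pow (p := 2) (by simp)).const_mul D).const_mul |c|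
  have hb : ∀ x, ‖inner ℝ (v.1 x) ((c • fderiv ℝ ψ x) (v.1 x))‖ ≤ |c| * (D * ‖v.1 x‖ ^ 2) := by
    intro x
    calc ‖inner ℝ (v.1 x) ((c • fderiv ℝ ψ x) (v.1 x))‖
        ≤ ‖v.1 x‖ * (|c| * (D * ‖v.1 x‖)) := by
          refine (norm_inner_le_norm _ _).trans ?_
          gcongr
          rw [smul_apply, norm_smul, Real.norm_eq_abs]
          gcongr
          exact (fderiv ℝ ψ x).le_of_opNorm_le (hD x) _
      _ = _ := by ring
  have hi2' : Integrable (fun x => inner ℝ (v.1 x) ((c • fderiv ℝ ψ x) (v.1 x))) := by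
    refine hi2.mono' (hv.1.inner ?_) (Filter.Eventually.of_forall hb)
    have hc : Continuous fun x => c • fderiv ℝ ψ x :=
      (h.smooth.continuous_fderiv (by simp)).const_smul c
    exact (ContinuousLinearMap.apply ℝ (EulerSpace n)).flip.aestronglyMeasurable_comp₂
      hc.aestronglyMeasurable hv.1
  rw [integral_add hi1' hi2']
  refine (abs_add_le _ _).trans (add_le_add ?_ ?_)
  · have h1 : ∫ x, inner ℝ (v.1 x) (a • ψ x) = a * inner ℝ v.1 w.1 := by
      rw [L2.inner_def, ← integral_const_mul]
      refine integral_congr_ae ?_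
      filter_upwards [hw] with x hx
      rw [hx, inner_smul_right]
    rw [h1, abs_mul]
    gcongr
    exact abs_real_inner_le_norm _ _
  · have h1 := norm_integral_le_of_norm_le hi2 (Filter.Eventually.of_forall hb)
    rwa [integral_const_mul, integral_const_mul, hv2] at h1

theorem toReal_eLpNorm_Icc_le {E : Type*} [NormedAddCommGroup E] {u : ℝ → E} {p q : ℝ≥0∞}
    (hqp : q ≤ p) {M S : ℝ} (hM : 0 ≤ M) (hS : 0 < S) (hu : MemLp u p timeMeasure)
    (huM : eLpNorm u p timeMeasure ≤ ENNReal.ofReal M) :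
    (eLpNorm u q (volume.restrict (Icc 0 S))).toReal ≤ M * S ^ (1 / q.toReal - 1 / p.toReal) := by
  have hle : volume.restrict (Icc 0 S) ≤ timeMeasure :=
    Measure.restrict_mono Icc_subset_Ici_self le_rfl
  have h1 := eLpNorm_le_eLpNorm_mul_rpow_measure_univ hqp (hu.1.mono_measure hle)
  have h2 : (volume.restrict (Icc 0 S)) univ = ENNReal.ofReal S := by simp
  rw [h2, ENNReal.ofReal_rpow_of_pos hS] at h1
  refine ENNReal.toReal_le_of_le_ofReal (by positivity) ?_
  rw [ENNReal.ofReal_mul hM]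
  exact h1.trans (mul_le_mul_left ((eLpNorm_mono_measure _ hle).trans huM) _)

/-- The test field χψ turns the equation into a formula for ⟨u⁰, w⟩. The two terms on the right come
from the L¹ and L² norms in time of u on [0, S], each controlled by Hölder. -/
theorem abs_inner_datum_le {n : ℕ} {ψ : EulerSpace n → EulerSpace n} {w : L2Solenoidal n}
    (h : IsSolenoidalField ψ) (hw : w.1 =ᵐ[volume] ψ) {D : ℝ} (hD : ∀ x, ‖fderiv ℝ ψ x‖ ≤ D)
    {χ : ℝ → ℝ} (hχ : ContDiff ℝ ∞ χ) {A S : ℝ} (hS0 : 0 < S) (hχ0 : χ 0 = 1)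
    (hχ1 : ∀ t, |χ t| ≤ 1) (hS : ∀ t, S < |t| → χ t = 0) (hA : ∀ t, |deriv χ t| ≤ A)
    {p : ℝ≥0∞} (hp : 2 ≤ p) {M : ℝ} (hM : 0 ≤ M) {u0 : L2Solenoidal n} {u : ℝ → L2Solenoidal n}
    (hu : MemLp u p timeMeasure) (huM : eLpNorm u p timeMeasure ≤ ENNReal.ofReal M)
    (hsol : IsWeakEulerSolution u0 u) :
    |inner ℝ u0 w| ≤ A * (M * S ^ (1 - 1 / p.toReal)) * ‖w‖
      + D * (M * S ^ (1 / 2 - 1 / p.toReal)) ^ 2 := by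
  have hD0 : 0 ≤ D := (norm_nonneg _).trans (hD 0)
  have hA0 : 0 ≤ A := (abs_nonneg _).trans (hA 0)
  have heq := hsol _ (h.isSolenoidalTest hχ hS)
  have hdat : ∫ x, inner ℝ (u0.1 x) (χ 0 • ψ x) = inner ℝ u0 w := by
    rw [Submodule.coe_inner, L2.inner_def]
    refine integral_congr_ae ?_
    filter_upwards [hw] with x hx
    rw [hx, hχ0, one_smul]
  rw [hdat] at heq
  rw [eq_neg_of_add_eq_zero_right heq, abs_neg]
  have hd : ∀ t x, deriv (fun s => χ s • ψ x) t = deriv χ t • ψ x := fun t x =>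
    deriv_smul_const (hχ.differentiable (by simp) t) _
  have hf : ∀ t x, fderiv ℝ (fun x => χ t • ψ x) x = χ t • fderiv ℝ ψ x := fun t x =>
    fderiv_fun_const_smul (h.smooth.differentiable (by simp) x) _
  simp only [hd, hf]
  set F : ℝ → ℝ := fun t => ∫ x, (inner ℝ ((u t).1 x) (deriv χ t • ψ x)
    + inner ℝ ((u t).1 x) ((χ t • fderiv ℝ ψ x) ((u t).1 x))) with hF
  have hF0 : ∀ t ∈ Ici (0 : ℝ) \ Icc 0 S, F t = 0 := by
    intro t ht
    have ht' : S < |t| := by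
      rw [abs_of_nonneg ht.1]
      by_contra! hc
      exact ht.2 ⟨ht.1, hc⟩
    simp [hF, hS t ht', deriv_eq_zero_of_lt hS ht']
  have hres : ∫ t, F t ∂timeMeasure = ∫ t in Icc 0 S, F t :=
    setIntegral_eq_of_subset_of_forall_sdiff_eq_zero measurableSet_Ici Icc_subset_Ici_self hF0
  rw [hres]
  have hle : volume.restrict (Icc 0 S) ≤ timeMeasure :=
    Measure.restrict_mono Icc_subset_Ici_self le_rfl
  have hup : MemLp u p (volume.restrict (Icc 0 S)) := hu.mono_measure hle
  have hu2 : MemLp u 2 (volume.restrict (Icc 0 S)) := hup.mono_exponent hp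
  have hu1 : MemLp u 1 (volume.restrict (Icc 0 S)) :=
    hup.mono_exponent (le_trans (by norm_num) hp)
  have hi1 : IntegrableOn (fun t => ‖u t‖) (Icc 0 S) := (memLp_one_iff_integrable.1 hu1).norm
  have hi2 : IntegrableOn (fun t => ‖u t‖ ^ 2) (Icc 0 S) :=
    hu2.integrable_norm_pow (p := 2) (by simp)
  have hI1 : ∫ t in Icc 0 S, ‖u t‖ ≤ M * S ^ (1 - 1 / p.toReal) := by
    rw [integral_norm_eq_lintegral_enorm hu1.1, ← eLpNorm_one_eq_lintegral_enorm]
    simpa using toReal_eLpNorm_Icc_le (le_trans (by norm_num) hp : (1 : ℝ≥0∞) ≤ p) hM hS0 hu huM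
  have hI2 : ∫ t in Icc 0 S, ‖u t‖ ^ 2 ≤ (M * S ^ (1 / 2 - 1 / p.toReal)) ^ 2 := by
    have h1 : ∫ t in Icc 0 S, ‖u t‖ ^ 2 = (eLpNorm u 2 (volume.restrict (Icc 0 S))).toReal ^ 2 := by
      have h0 : 0 ≤ ∫ t in Icc 0 S, ‖u t‖ ^ 2 := integral_nonneg fun t => by positivity
      rw [hu2.eLpNorm_eq_integral_rpow_norm (by simp) (by simp)]
      simp only [ENNReal.toReal_ofNat, Real.rpow_ofNat]
      rw [ENNReal.toReal_ofReal (by positivity), ← Real.rpow_natCast, ← Real.rpow_mul h0]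
      norm_num
    rw [h1]
    gcongr
    simpa using toReal_eLpNorm_Icc_le hp hM hS0 hu huM
  have hbound : ∀ t, ‖F t‖ ≤ A * ‖w‖ * ‖u t‖ + D * ‖u t‖ ^ 2 := fun t =>
    calc ‖F t‖ ≤ |deriv χ t| * (‖u t‖ * ‖w‖) + |χ t| * (D * ‖u t‖ ^ 2) :=
          abs_integral_pairing_le h hw hD (u t) _ _
      _ ≤ A * (‖u t‖ * ‖w‖) + 1 * (D * ‖u t‖ ^ 2) := by
          gcongr
          · exact hA t
          · exact hχ1 t
      _ = _ := by ring
  calc |∫ t in Icc 0 S, F t| ≤ ∫ t in Icc 0 S, (A * ‖w‖ * ‖u t‖ + D * ‖u t‖ ^ 2) :=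
        norm_integral_le_of_norm_le ((hi1.const_mul _).add (hi2.const_mul _))
          (Filter.Eventually.of_forall hbound)
    _ = A * ‖w‖ * (∫ t in Icc 0 S, ‖u t‖) + D * ∫ t in Icc 0 S, ‖u t‖ ^ 2 := by
        rw [integral_add (hi1.const_mul _) (hi2.const_mul _), integral_const_mul,
          integral_const_mul]
    _ ≤ A * ‖w‖ * (M * S ^ (1 - 1 / p.toReal)) + D * (M * S ^ (1 / 2 - 1 / p.toReal)) ^ 2 := by
        gcongr
    _ = _ := by ring

/-! ### Thin slabs and nowhere density -/

/-- The data of weak Euler solutions of norm at most `M` in `L^p_t L²_x`. -/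
def eulerData (n : ℕ) (p : ℝ≥0∞) (M : ℝ) : Set (L2Solenoidal n) :=
  {u0 | ∃ u : ℝ → L2Solenoidal n, MemLp u p timeMeasure ∧
    eLpNorm u p timeMeasure ≤ ENNReal.ofReal M ∧ IsWeakEulerSolution u0 u}

/-- In a suitable direction `w` the solvable data, and hence their closure, are confined to a slab
which is as thin as desired. -/
theorem exists_slab {n : ℕ} (hn : 2 ≤ n) {p : ℝ≥0∞} (hp : 2 ≤ p) (hp' : p < ⊤) {M : ℝ}
    (hM : 0 < M) {δ : ℝ} (hδ : 0 < δ) :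
    ∃ w : L2Solenoidal n, 0 < ‖w‖ ∧
      closure (eulerData n p M) ⊆ {u0 | |inner ℝ u0 w| ≤ δ * ‖w‖} := by
  obtain ⟨C, hC0, hC⟩ := exists_time_cutoff
  have hpR : 0 < p.toReal := ENNReal.toReal_pos (by rintro rfl; simp at hp) hp'.ne
  have hlim : Filter.Tendsto (fun S : ℝ => C * M * S ^ (-(1 / p.toReal))) Filter.atTop (nhds 0) := by
    simpa using (tendsto_rpow_neg_atTop (one_div_pos.2 hpR)).const_mul (C * M)
  -- The order of choices matters: S depends only on C, M, p and δ, and the spatial field is chosen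
  -- afterwards, against the constant K determined by S. Each term receives δ/2.
  obtain ⟨S, hSδ, hS⟩ := ((hlim.eventually (gt_mem_nhds (half_pos hδ))).and
    (Filter.eventually_gt_atTop 0)).exists
  obtain ⟨χ, hχ, hχ0, hχ1, hχS, hχd⟩ := hC S hS
  set K : ℝ := (M * S ^ (1 / 2 - 1 / p.toReal)) ^ 2 with hK
  have hK0 : 0 < K := by positivity
  obtain ⟨ψ, w, hψ, hw, hw0, hD⟩ := exists_solenoidalField_fderiv_le hn
    (div_pos (half_pos hδ) hK0)
  refine ⟨w, hw0, closure_minimal ?_ ?_⟩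
  · rintro u0 ⟨u, hu, huM, hsol⟩
    have := abs_inner_datum_le hψ hw hD hχ hS hχ0 hχ1 hχS hχd hp hM.le hu huM hsol
    refine this.trans ?_
    have e1 : C / S * (M * S ^ (1 - 1 / p.toReal)) = C * M * S ^ (-(1 / p.toReal)) := by
      rw [sub_eq_add_neg, Real.rpow_add hS, Real.rpow_one]
      field_simp
    rw [e1, ← hK]
    have e2 : δ / 2 / K * ‖w‖ * K = δ / 2 * ‖w‖ := by field_simp
    rw [e2]
    nlinarith
  · exact isClosed_le (by fun_prop) continuous_const

theorem isNowhereDense_eulerData {n : ℕ} (hn : 2 ≤ n) {p : ℝ≥0∞} (hp : 2 ≤ p) (hp' : p < ⊤)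
    {M : ℝ} (hM : 0 < M) : IsNowhereDense (eulerData n p M) := by
  rw [IsNowhereDense, eq_empty_iff_forall_notMem]
  intro v hv
  obtain ⟨r, hr, hball⟩ := Metric.mem_nhds_iff.1 (mem_interior_iff_mem_nhds.1 hv)
  -- Moving from v by r/2 along w stays in the ball but changes the pairing with w by r/2 · ‖w‖,
  -- more than the slab's total width r/4 · ‖w‖.
  obtain ⟨w, hw, hslab⟩ := exists_slab hn hp hp' hM (δ := r / 8) (by positivity)
  have h1 : |inner ℝ v w| ≤ r / 8 * ‖w‖ := hslab (hball (Metric.mem_ball_self hr))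
  have hmem : v + (r / 2 / ‖w‖) • w ∈ Metric.ball v r := by
    rw [Metric.mem_ball, dist_self_add_left, norm_smul, Real.norm_of_nonneg (by positivity),
      div_mul_cancel₀ _ hw.ne']
    linarith
  have h2 : |inner ℝ (v + (r / 2 / ‖w‖) • w) w| ≤ r / 8 * ‖w‖ := hslab (hball hmem)
  have h3 : inner ℝ ((r / 2 / ‖w‖) • w) w = r / 2 * ‖w‖ := by
    refine (real_inner_smul_left w w _).trans ?_
    rw [real_inner_self_eq_norm_sq]
    field_simp
  rw [inner_add_left, h3] at h2
  have h4 := abs_le.1 h1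
  have h5 := abs_le.1 h2
  have : 0 < r * ‖w‖ := by positivity
  linarith [h4.1, h5.2]

/-! ### Interpolation and the residual set -/

/-- Almost everywhere ‖u‖^q ≤ ‖u‖_∞^(q-p) ‖u‖^p. -/
theorem MeasureTheory.MemLp.of_memLp_top_of_le {α E : Type*} {m : MeasurableSpace α}
    {μ : Measure α} [NormedAddCommGroup E] {u : α → E} {p q : ℝ≥0∞} (hp0 : p ≠ 0) (hpq : p ≤ q)
    (hq : q ≠ ⊤) (hu : MemLp u p μ) (htop : MemLp u ⊤ μ) : MemLp u q μ := by
  have hp : p ≠ ⊤ := ne_top_of_le_ne_top hq hpq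
  have hpR : 0 < p.toReal := ENNReal.toReal_pos hp0 hp
  have hpqR : p.toReal ≤ q.toReal := ENNReal.toReal_mono hq hpq
  have hq0 : q ≠ 0 := fun h => hp0 (le_antisymm (h ▸ hpq) bot_le)
  refine ⟨hu.1, ?_⟩
  rw [eLpNorm_lt_top_iff_lintegral_rpow_enorm_lt_top hq0 hq]
  have h1 := (eLpNorm_lt_top_iff_lintegral_rpow_enorm_lt_top hp0 hp).1 hu.2
  have hK : eLpNorm u ⊤ μ ^ (q.toReal - p.toReal) < ⊤ :=
    ENNReal.rpow_lt_top_of_nonneg (by linarith) htop.2.ne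
  refine lt_of_le_of_lt ?_ (ENNReal.mul_lt_top hK h1)
  rw [← lintegral_const_mul' _ _ hK.ne]
  refine lintegral_mono_ae ?_
  rw [eLpNorm_exponent_top]
  filter_upwards [enorm_ae_le_eLpNormEssSup u μ] with x hx
  calc ‖u x‖ₑ ^ q.toReal = ‖u x‖ₑ ^ (q.toReal - p.toReal) * ‖u x‖ₑ ^ p.toReal := by
        rw [← ENNReal.rpow_add_of_nonneg _ _ (by linarith) hpR.le]
        ring_nf
    _ ≤ _ := by gcongr

theorem corollaryE (n : ℕ) (hn : 2 ≤ n) :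
    (∀ p : ℝ≥0∞, 2 < p → p < ⊤ → ∀ M : ℝ, 0 < M →
      IsNowhereDense {u0 : L2Solenoidal n | ∃ u : ℝ → L2Solenoidal n,
        MemLp u p timeMeasure ∧ eLpNorm u p timeMeasure ≤ ENNReal.ofReal M ∧
        IsWeakEulerSolution u0 u}) ∧
    (∃ G : Set (L2Solenoidal n), IsGδ G ∧ G ∈ residual (L2Solenoidal n) ∧
      ∀ u0 ∈ G, ¬ ∃ u : ℝ → L2Solenoidal n,
        MemLp u ⊤ timeMeasure ∧
        (∃ p : ℝ≥0∞, 2 < p ∧ p < ⊤ ∧ MemLp u p timeMeasure) ∧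
        IsWeakEulerSolution u0 u) := by
  refine ⟨fun p hp hp' M hM => isNowhereDense_eulerData hn hp.le hp' hM, ?_⟩
  -- Integer exponents and bounds suffice; the shifts keep the exponent at least 2 and the bound
  -- positive.
  have hopen : ∀ k : ℕ × ℕ,
      IsOpen (closure (eulerData n ((k.1 + 2 : ℕ) : ℝ≥0∞) (k.2 + 1 : ℝ)))ᶜ :=
    fun k => isClosed_closure.isOpen_compl
  refine ⟨⋂ k : ℕ × ℕ, (closure (eulerData n ((k.1 + 2 : ℕ) : ℝ≥0∞) (k.2 + 1 : ℝ)))ᶜ,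
    IsGδ.iInter_of_isOpen hopen, countable_iInter_mem.2 fun k => ?_, ?_⟩
  · refine residual_of_dense_open (hopen k) (interior_eq_empty_iff_dense_compl.1 ?_)
    exact isNowhereDense_eulerData hn (by exact_mod_cast (by omega : 2 ≤ k.1 + 2))
      (ENNReal.natCast_lt_top _) (by positivity)
  · rintro u0 hu0 ⟨u, htop, ⟨p, hp, hp', hup⟩, hsol⟩
    -- The unknown real exponent p is replaced by an integer above it, which the L^∞ bound permits.
    obtain ⟨k, hk⟩ := ENNReal.exists_nat_gt hp'.ne
    have hq : MemLp u ((k + 2 : ℕ) : ℝ≥0∞) timeMeasure :=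
      hup.of_memLp_top_of_le (by rintro rfl; simp at hp)
        (hk.le.trans (by exact_mod_cast Nat.le_add_right k 2)) (ENNReal.natCast_ne_top _) htop
    obtain ⟨m, hm⟩ := ENNReal.exists_nat_gt hq.2.ne
    refine mem_iInter.1 hu0 (k, m) (subset_closure ⟨u, hq, ?_, hsol⟩)
    refine hm.le.trans ?_
    rw [← ENNReal.ofReal_natCast]
    exact ENNReal.ofReal_le_ofReal (by simp)
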